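/- Let $X$ be a finite set and $S:X\times X\to X\times X$ a bijection, written $S(x,y)=(g_x(y),f_y(x))$, such that $S_1S_2S_1=S_2S_1S_2$ on $X\times X\times X$, where $S_1=S\times\mathrm{id}$ and $S_2=\mathrm{id}\times S$. Assume that $(X,S)$ is nondegenerate, i.e. that all the maps $g_x:X\to X$ and $f_y:X\to X$ are bijections. Let $G_X$ be the group generated by the elements of $X$ with the relations $xy=y_1x_1$ whenever $S(x,y)=(y_1,x_1)$. Let $A_X$ be the group generated by the elements of $X$ with the relations $x_1\bullet y=y_2\bullet x_1$ whenever $S(x,y)=(y_1,x_1)$ and $S(y_1,x_1)=(x_2,y_2)$. Put $$\phi(y,x)=f_x\bigl(g_{f_y^{-1}(x)}(y)\bigr),$$ and let $\sim$ be the smallest equivalence relation on $X$ such that $y\sim\phi(y,x)$ for all $x,y\in X$. For a group $G$ that has an abelian subgroup of finite index, the rank of $G$ is the rank (as a $\mathbb Z$-module) of an abelian subgroup of finite index; it does not depend on the choice of the subgroup. Then $A_X$ and $G_X$ both have abelian subgroups of finite index, and the rank of $A_X$ and the rank of $G_X$ are both equal to the number of equivalence classes of $\sim$ on $X$. -/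

import Mathlib

namespace BraidedSet

open scoped IsMulCommutative

variable {X : Type*}

/-- The first component of `S`, in the notation `S (x, y) = (g_x y, f_y x)`. -/
def g (S : X × X → X × X) (x y : X) : X := (S (x, y)).1

/-- The second component of `S`, in the notation `S (x, y) = (g_x y, f_y x)`;
the index of `f_y` is the first argument. -/
def f (S : X × X → X × X) (y x : X) : X := (S (x, y)).2

/-- `S × id` on `X × X × X`. -/
def S₁ (S : X × X → X × X) (t : X × X × X) : X × X × X :=
  ((S (t.1, t.2.1)).1, (S (t.1, t.2.1)).2, t.2.2)

/-- `id × S` on `X × X × X`. -/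
def S₂ (S : X × X → X × X) (t : X × X × X) : X × X × X :=
  (t.1, S t.2)

/-- `(X, S)` is a braided set: `S` is bijective and `S₁ S₂ S₁ = S₂ S₁ S₂`. -/
structure IsBraided (S : X × X → X × X) : Prop where
  bijective : Function.Bijective S
  braid : S₁ S ∘ S₂ S ∘ S₁ S = S₂ S ∘ S₁ S ∘ S₂ S

/-- `(X, S)` is nondegenerate: all the maps `g_x` and `f_y` are bijections of `X`. -/
structure IsNondegenerate (S : X × X → X × X) : Prop where
  g_bijective : ∀ x, Function.Bijective (g S x)
  f_bijective : ∀ y, Function.Bijective (f S y)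

/-- The relators of the structure group: `x y = y₁ x₁` whenever `S (x, y) = (y₁, x₁)`. -/
def structureRels (S : X × X → X × X) : Set (FreeGroup X) :=
  {r | ∃ x y y₁ x₁ : X, S (x, y) = (y₁, x₁) ∧
    r = (FreeGroup.of x * FreeGroup.of y) * (FreeGroup.of y₁ * FreeGroup.of x₁)⁻¹}

/-- The structure group `G_X`. -/
abbrev StructureGroup (S : X × X → X × X) : Type _ := PresentedGroup (structureRels S)

/-- The relators of the derived structure group: `x₁ • y = y₂ • x₁` whenever
`S (x, y) = (y₁, x₁)` and `S (y₁, x₁) = (x₂, y₂)`. -/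
def derivedRels (S : X × X → X × X) : Set (FreeGroup X) :=
  {r | ∃ x y y₁ x₁ x₂ y₂ : X, S (x, y) = (y₁, x₁) ∧ S (y₁, x₁) = (x₂, y₂) ∧
    r = (FreeGroup.of x₁ * FreeGroup.of y) * (FreeGroup.of y₂ * FreeGroup.of x₁)⁻¹}

/-- The derived structure group `A_X`. -/
abbrev DerivedStructureGroup (S : X × X → X × X) : Type _ := PresentedGroup (derivedRels S)

/-- The permutation `x ↦ y * x = f_y⁻¹ x` by which the generator `y` of `G_X` acts
in the left `*`-action on `X`. -/
noncomputable def starPerm {S : X × X → X × X} (hS : IsNondegenerate S) (y : X) : Equiv.Perm X :=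
  (Equiv.ofBijective (f S y) (hS.f_bijective y))⁻¹

/-- `φ (y, x) = x⁻¹ * ((y * x) ∘ y)`, where `y * x = f_y⁻¹ x` and `x ∘ y = g_x y`. -/
noncomputable def phi {S : X × X → X × X} (hS : IsNondegenerate S) (y x : X) : X :=
  (starPerm hS x)⁻¹ (g S (starPerm hS y x) y)

/-- The smallest equivalence relation on `X` with `y ∼ φ (y, x)` for all `x` and `y`. -/
def equivalence {S : X × X → X × X} (hS : IsNondegenerate S) : Setoid X :=
  Relation.EqvGen.setoid fun y z => ∃ x, z = phi hS y x

/-- `G` has an abelian subgroup of finite index, and the rank of `G`, which is the rank of any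
abelian subgroup of finite index (as a `ℤ`-module), is `n`. -/
def HasRank (G : Type*) [Group G] (n : ℕ) : Prop :=
  (∃ Γ : Subgroup G, IsMulCommutative Γ ∧ Γ.FiniteIndex) ∧
    ∀ (Γ : Subgroup G) [IsMulCommutative Γ], Γ.FiniteIndex →
      Module.rank ℤ (Additive Γ) = (n : Cardinal)

end BraidedSet

/-! In `A_X` the relation reads `x • y = φ(y, x) • x`, so conjugation permutes the finite set of
generators and the centre has finite index `n` (`center_finiteIndex`). The transfer to the centre is
`a ↦ a ^ n`; it is constant on classes of `∼`, so it factors through the map from `A_X` to the free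
abelian group on the classes. The resulting maps between that group and the centre compose to
multiplication by `n` both ways, so the ranks agree.

For `G_X`, the braid relation makes `y * x = f_y⁻¹ x` an action on `X` that commutes with `φ`, hence
an action on `A_X` by automorphisms. There is a cocycle `π : G_X → A_X` fixing generators, with
`π(hk) = k⁻¹(π h) π(k)`. It is bijective (`cocycle_bijective`) and multiplicative in `k` on the
finite-index kernel of the action, which suffices to transport the rank (`HasRank.of_bijective`). -/

namespace BraidedSet

universe u

/-! ### Rank of virtually abelian groups -/

section Rank

open scoped IsMulCommutative

/-- The rank does not decrease along an additive map which becomes multiplication by a nonzero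
integer after composing with another map. -/
theorem rank_le_of_comp_eq_nsmul {M N : Type u} [AddCommGroup M] [AddCommGroup N] {n : ℕ}
    (hn : n ≠ 0) (p : M →+ N) (q : N →+ M) (h : ∀ m, q (p m) = n • m) :
    Module.rank ℤ M ≤ Module.rank ℤ N := by
  rw [Module.rank_def ℤ M]
  refine ciSup_le' fun ⟨s, hs⟩ => ?_
  refine LinearIndependent.cardinal_le_rank (v := fun m : s => p m) ?_
  rw [LinearIndepOn, linearIndependent_iff'] at hs
  rw [linearIndependent_iff']
  intro t c hc i hi
  have h1 : ∑ i ∈ t, (n * c i) • (i : M) = 0 := by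
    have := congrArg q hc
    rw [map_zero, map_sum] at this
    rw [← this]
    refine Finset.sum_congr rfl fun i _ => ?_
    rw [map_zsmul, h, ← natCast_zsmul, smul_smul, mul_comm]
  simpa [hn] using hs t (fun i => n * c i) h1 i hi

theorem rank_eq_of_comp_eq_nsmul {M N : Type u} [AddCommGroup M] [AddCommGroup N] {n : ℕ}
    (hn : n ≠ 0) (p : M →+ N) (q : N →+ M) (h : ∀ m, q (p m) = n • m)
    (h' : ∀ m, p (q m) = n • m) : Module.rank ℤ M = Module.rank ℤ N :=
  (rank_le_of_comp_eq_nsmul hn p q h).antisymm (rank_le_of_comp_eq_nsmul hn q p h')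

theorem rank_additive_eq_of_mulEquiv {G H : Type u} [Group G] [Group H] [IsMulCommutative G]
    [IsMulCommutative H] (e : G ≃* H) :
    Module.rank ℤ (Additive G) = Module.rank ℤ (Additive H) :=
  (MulEquiv.toAdditive e).toIntLinearEquiv.rank_eq

/-- A subgroup of finite index of an abelian group has the same rank. -/
theorem rank_additive_subgroup {G : Type u} [Group G] [IsMulCommutative G] (N : Subgroup G)
    [N.FiniteIndex] : Module.rank ℤ (Additive N) = Module.rank ℤ (Additive G) :=
  rank_eq_of_comp_eq_nsmul (n := N.index) Subgroup.FiniteIndex.index_ne_zero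
    (MonoidHom.toAdditive N.subtype)
    -- The inclusion is inverted, up to the index, by the power map into `N`.
    (MonoidHom.toAdditive ((powMonoidHom N.index).codRestrict N fun g => N.pow_index_mem g))
    (fun _ => rfl) (fun _ => rfl)

/-- The rank can be computed on any abelian subgroup of finite index. -/
theorem HasRank.of_subgroup {G : Type u} [Group G] {n : ℕ} (Γ : Subgroup G) [IsMulCommutative Γ]
    [Γ.FiniteIndex] (h : Module.rank ℤ (Additive Γ) = n) : HasRank G n := by
  refine ⟨⟨Γ, inferInstance, inferInstance⟩, fun Δ _ _ => ?_⟩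
  -- Both sides are `Γ ∩ Δ`, of finite index in each of `Γ` and `Δ`.
  let e : Γ.subgroupOf Δ ≃* Δ.subgroupOf Γ :=
    { toFun := fun x => ⟨⟨x.1.1, x.2⟩, x.1.2⟩
      invFun := fun x => ⟨⟨x.1.1, x.2⟩, x.1.2⟩
      left_inv := fun _ => rfl
      right_inv := fun _ => rfl
      map_mul' := fun _ _ => rfl }
  rw [← h, ← rank_additive_subgroup (Γ.subgroupOf Δ),
    ← rank_additive_subgroup (Δ.subgroupOf Γ)]
  exact rank_additive_eq_of_mulEquiv e

/-- A bijection of groups which is multiplicative on the right with respect to a subgroup of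
finite index transports the rank. -/
theorem HasRank.of_bijective {G A : Type u} [Group G] [Group A] {n : ℕ} (hA : HasRank A n)
    (K : Subgroup G) [K.FiniteIndex] (p : G → A) (hp : Function.Bijective p)
    (hmul : ∀ h, ∀ k ∈ K, p (h * k) = p h * p k) : HasRank G n := by
  obtain ⟨⟨Z, hZ, hZi⟩, hrank⟩ := hA
  let P : K →* A := MonoidHom.mk' (fun k => p k) fun a b => hmul a b b.2
  have hP : Function.Injective P := hp.1.comp Subtype.val_injective
  have hPi : P.range.FiniteIndex := by
    -- Right multiplicativity sends left cosets of `K` into left cosets of the image, so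
    -- surjectivity of `p` bounds the index of the image.
    let q : G ⧸ K → A ⧸ P.range := Quotient.map' p fun a b hab => by
      rw [QuotientGroup.leftRel_apply] at hab ⊢
      refine ⟨⟨_, hab⟩, ?_⟩
      have := hmul a _ hab
      rw [mul_inv_cancel_left] at this
      simp [P, this]
    have hq : Function.Surjective q := by
      intro x
      induction x using QuotientGroup.induction_on with
      | H a =>
        obtain ⟨g, rfl⟩ := hp.2 a
        exact ⟨(g : G ⧸ K), rfl⟩
    have := Finite.of_surjective q hq
    exact Subgroup.finiteIndex_of_finite_quotient
  let Γ : Subgroup K := Z.comap P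
  have : IsMulCommutative Γ := Z.comap_injective_isMulCommutative hP
  have hΓ : Γ.FiniteIndex := ⟨by
    rw [Subgroup.index_comap]
    exact Z.isFiniteRelIndex_of_finiteIndex.relIndex_ne_zero⟩
  have : (Γ.map K.subtype).FiniteIndex := ⟨by
    rw [Subgroup.index_map_subtype]
    exact mul_ne_zero hΓ.index_ne_zero Subgroup.FiniteIndex.index_ne_zero⟩
  have : (Γ.map P).FiniteIndex := by
    rw [Subgroup.map_comap_eq]
    infer_instance
  refine HasRank.of_subgroup (Γ.map K.subtype) ?_
  rw [← hrank (Γ.map P) inferInstance]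
  exact rank_additive_eq_of_mulEquiv
    ((Γ.equivMapOfInjective _ K.subtype_injective).symm.trans (Γ.equivMapOfInjective P hP))

end Rank

/-! ### Consequences of the braid relation for `*` and `φ` -/

section Identities

variable {X : Type*} {S : X × X → X × X}

theorem IsBraided.components (hb : IsBraided S) (x y z : X) :
    g S (g S x y) (g S (f S y x) z) = g S x (g S y z) ∧
      f S (g S (f S y x) z) (g S x y) = g S (f S (g S y z) x) (f S z y) ∧
        f S z (f S y x) = f S (f S z y) (f S (g S y z) x) := by
  have h := congrFun hb.braid (x, y, z)
  simpa [S₁, S₂, g, f, Prod.ext_iff] using h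

theorem f_starPerm (hS : IsNondegenerate S) (y x : X) : f S y (starPerm hS y x) = x :=
  Equiv.apply_symm_apply (Equiv.ofBijective (f S y) (hS.f_bijective y)) x

theorem starPerm_f (hS : IsNondegenerate S) (y x : X) : starPerm hS y (f S y x) = x :=
  Equiv.symm_apply_apply (Equiv.ofBijective (f S y) (hS.f_bijective y)) x

theorem phi_eq (hS : IsNondegenerate S) (y x : X) :
    phi hS y x = f S x (g S (starPerm hS y x) y) := by
  rw [phi, starPerm, inv_inv]
  rfl

/-- Substituting `x = f_y a` removes the inverse from `φ`: what remains is the second component of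
`S (S (a, y))`. -/
theorem phi_f (hS : IsNondegenerate S) (y a : X) :
    phi hS y (f S y a) = f S (f S y a) (g S a y) := by
  rw [phi_eq, starPerm_f]

theorem phi_f_f (hb : IsBraided S) (hS : IsNondegenerate S) (z y x : X) :
    phi hS (f S z y) (f S z x) = f S z (phi hS y x) := by
  obtain ⟨a, rfl⟩ := (hS.f_bijective y).2 x
  rw [phi_f, (hb.components (g S a y) (f S y a) z).2.2, (hb.components a y z).2.1,
    (hb.components a y z).2.2, phi_f]

theorem phi_starPerm_starPerm (hb : IsBraided S) (hS : IsNondegenerate S) (z y x : X) :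
    phi hS (starPerm hS z y) (starPerm hS z x) = starPerm hS z (phi hS y x) := by
  rw [← starPerm_f hS z (phi hS (starPerm hS z y) _), ← phi_f_f hb, f_starPerm, f_starPerm]

theorem starPerm_mul_starPerm (hb : IsBraided S) (hS : IsNondegenerate S) (x y : X) :
    starPerm hS x * starPerm hS y = starPerm hS (g S x y) * starPerm hS (f S y x) := by
  ext z
  obtain ⟨w, rfl⟩ := (hS.f_bijective y).2 z
  obtain ⟨w, rfl⟩ := (hS.f_bijective x).2 w
  rw [Equiv.Perm.mul_apply, Equiv.Perm.mul_apply, starPerm_f, starPerm_f,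
    (hb.components w x y).2.2, starPerm_f, starPerm_f]

/-- The map `w ↦ w * w` is a bijection of `X`. -/
theorem starPerm_self_bijective [Finite X] (hb : IsBraided S) (hS : IsNondegenerate S) :
    Function.Bijective fun w => starPerm hS w w := by
  -- By equivariance of `φ`, the element `v = w * w` determines `g_v w`, and `g_v` is injective, so
  -- `v` determines `w`.
  have key (w : X) : g S (starPerm hS w w) w = phi hS (starPerm hS w w) (starPerm hS w w) := by
    rw [phi_starPerm_starPerm hb, phi_eq, starPerm_f]
  refine Finite.injective_iff_bijective.1 fun w w' h => ?_
  have h1 := (key w).trans ((congrArg (fun v => phi hS v v) h).trans (key w').symm)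
  rw [show starPerm hS w w = starPerm hS w' w' from h] at h1
  exact (hS.g_bijective _).1 h1

end Identities

/-! ### Relations and universal properties of `G_X` and `A_X` -/

section Groups

variable {X : Type u} {S : X × X → X × X}

theorem structureGroup_rel (x y : X) :
    (PresentedGroup.of x * PresentedGroup.of y : StructureGroup S) =
      PresentedGroup.of (g S x y) * PresentedGroup.of (f S y x) := by
  have h : PresentedGroup.mk (structureRels S) _ = 1 :=
    PresentedGroup.one_of_mem ⟨x, y, g S x y, f S y x, rfl, rfl⟩
  rwa [map_mul, map_inv, mul_inv_eq_one, map_mul, map_mul] at h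

theorem derivedStructureGroup_rel (hS : IsNondegenerate S) (x y : X) :
    (PresentedGroup.of x * PresentedGroup.of y : DerivedStructureGroup S) =
      PresentedGroup.of (phi hS y x) * PresentedGroup.of x := by
  obtain ⟨a, rfl⟩ := (hS.f_bijective y).2 x
  have h : PresentedGroup.mk (derivedRels S) _ = 1 := PresentedGroup.one_of_mem
    ⟨a, y, g S a y, f S y a, g S (g S a y) (f S y a), f S (f S y a) (g S a y), rfl, rfl, rfl⟩
  rw [map_mul, map_inv, mul_inv_eq_one, map_mul, map_mul] at h
  rwa [phi_f]

/-- Homomorphisms out of the structure group. -/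
def StructureGroup.lift {H : Type*} [Group H] (F : X → H)
    (hF : ∀ x y, F x * F y = F (g S x y) * F (f S y x)) : StructureGroup S →* H :=
  PresentedGroup.toGroup (f := F) <| by
    rintro _ ⟨x, y, y₁, x₁, h, rfl⟩
    obtain ⟨rfl, rfl⟩ := Prod.ext_iff.1 h
    rw [map_mul, map_inv, mul_inv_eq_one, map_mul, map_mul]
    simp only [FreeGroup.lift_apply_of]
    exact hF x y

@[simp]
theorem StructureGroup.lift_of {H : Type*} [Group H] (F : X → H)
    (hF : ∀ x y, F x * F y = F (g S x y) * F (f S y x)) (x : X) :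
    StructureGroup.lift F hF (PresentedGroup.of x) = F x :=
  PresentedGroup.toGroup.of _

/-- Homomorphisms out of the derived structure group. -/
def DerivedStructureGroup.lift (hS : IsNondegenerate S) {H : Type*} [Group H] (F : X → H)
    (hF : ∀ x y, F x * F y = F (phi hS y x) * F x) : DerivedStructureGroup S →* H :=
  PresentedGroup.toGroup (f := F) <| by
    rintro _ ⟨x, y, y₁, x₁, x₂, y₂, h, h', rfl⟩
    obtain ⟨rfl, rfl⟩ := Prod.ext_iff.1 h
    obtain ⟨rfl, rfl⟩ := Prod.ext_iff.1 h'
    have := hF (f S y x) y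
    rw [phi_f] at this
    rw [map_mul, map_inv, mul_inv_eq_one, map_mul, map_mul]
    simp only [FreeGroup.lift_apply_of]
    exact this

@[simp]
theorem DerivedStructureGroup.lift_of (hS : IsNondegenerate S) {H : Type*} [Group H] (F : X → H)
    (hF : ∀ x y, F x * F y = F (phi hS y x) * F x) (x : X) :
    DerivedStructureGroup.lift hS F hF (PresentedGroup.of x) = F x :=
  PresentedGroup.toGroup.of _

end Groups

/-! ### The rank of `A_X` -/

section DerivedRank

open scoped IsMulCommutative

variable {X : Type u} [Finite X] {S : X × X → X × X}

theorem exists_conj_of (hS : IsNondegenerate S) (a : DerivedStructureGroup S) :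
    ∀ y : X, ∃ z : X, a * PresentedGroup.of y * a⁻¹ = PresentedGroup.of z := by
  have ha : a ∈ Subgroup.closure (Set.range PresentedGroup.of) := by
    rw [PresentedGroup.closure_range_of]
    trivial
  induction ha using Subgroup.closure_induction with
  | mem _ h =>
    obtain ⟨x, rfl⟩ := h
    exact fun y => ⟨phi hS y x, by rw [derivedStructureGroup_rel hS, mul_inv_cancel_right]⟩
  | one => exact fun y => ⟨y, by simp⟩
  | mul a b _ _ ha hb =>
    intro y
    obtain ⟨z, hz⟩ := hb y
    obtain ⟨w, hw⟩ := ha z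
    exact ⟨w, by rw [← hw, ← hz]; group⟩
  | inv a _ ha =>
    choose c hc using ha
    -- Conjugation by `a` is an injective self-map of the finite set `T`, hence surjective. The
    -- image of `X` is used because `X → A_X` need not be injective.
    let T : Set (DerivedStructureGroup S) := Set.range PresentedGroup.of
    let C : T → T := fun t => ⟨a * t * a⁻¹, by
      obtain ⟨_, y, rfl⟩ := t
      exact ⟨_, (hc y).symm⟩⟩
    have hC : Function.Injective C := fun s t h => by
      have := congrArg Subtype.val h
      simpa [C, Subtype.ext_iff] using this
    intro y
    obtain ⟨⟨_, z, rfl⟩, ht⟩ := (Finite.injective_iff_surjective.1 hC) ⟨_, y, rfl⟩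
    have ht := congrArg Subtype.val ht
    simp only [C] at ht
    exact ⟨z, by rw [← ht]; group⟩

/-- The centre is the intersection of the centralizers of finitely many generators; a left coset of
the centralizer of `y` is determined by the conjugate of `y`, for which there are finitely many
choices. -/
theorem center_finiteIndex (hS : IsNondegenerate S) :
    (Subgroup.center (DerivedStructureGroup S)).FiniteIndex := by
  rw [Subgroup.center_eq_infi' (PresentedGroup.closure_range_of _)]
  refine Subgroup.finiteIndex_iInf fun ⟨_, y, rfl⟩ => ?_
  choose c hc using fun a => exists_conj_of hS a y
  let C := Subgroup.centralizer {(PresentedGroup.of y : DerivedStructureGroup S)}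
  have hfin : Finite (DerivedStructureGroup S ⧸ C) := by
    refine Finite.of_injective (fun q : DerivedStructureGroup S ⧸ C => c q.out) fun q r h => ?_
    have h1 := (hc q.out).trans ((congrArg _ h).trans (hc r.out).symm)
    rw [← QuotientGroup.out_eq' q, ← QuotientGroup.out_eq' r, QuotientGroup.eq,
      Subgroup.mem_centralizer_singleton_iff]
    rw [mul_assoc, mul_inv_eq_iff_eq_mul.1 h1.symm]
    group
  exact Subgroup.finiteIndex_of_finite_quotient

variable (S) in
/-- The homomorphism which sends a generator to the basis vector of its class. -/
noncomputable def classHom (hS : IsNondegenerate S) :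
    DerivedStructureGroup S →* Multiplicative (Quotient (equivalence hS) →₀ ℤ) :=
  DerivedStructureGroup.lift hS
    (fun x => Multiplicative.ofAdd (Finsupp.single (Quotient.mk _ x) 1)) fun x y => by
      have : (Quotient.mk (equivalence hS) y) = Quotient.mk _ (phi hS y x) :=
        Quotient.sound (Relation.EqvGen.rel _ _ ⟨x, rfl⟩)
      rw [mul_comm, this]

theorem derivedStructureGroup_hasRank (hS : IsNondegenerate S) :
    HasRank (DerivedStructureGroup S) (Nat.card (Quotient (equivalence hS))) := by
  have := center_finiteIndex hS
  refine HasRank.of_subgroup (Subgroup.center (DerivedStructureGroup S)) ?_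
  let τ := MonoidHom.transferCenterPow (DerivedStructureGroup S)
  let n := (Subgroup.center (DerivedStructureGroup S)).index
  -- The target of `τ` is commutative, so `x` cancels from the defining relation.
  have hτ : ∀ x y : X, τ (PresentedGroup.of y) = τ (PresentedGroup.of (phi hS y x)) := by
    intro x y
    have := congrArg τ (derivedStructureGroup_rel hS x y)
    rwa [map_mul, map_mul, mul_comm, mul_left_inj] at this
  let t : Quotient (equivalence hS) → Additive (Subgroup.center (DerivedStructureGroup S)) :=
    Quotient.lift (fun x => Additive.ofMul (τ (PresentedGroup.of x))) fun x y h => by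
      induction h with
      | rel x y h =>
        obtain ⟨z, rfl⟩ := h
        exact congrArg _ (hτ z x)
      | refl => rfl
      | symm _ _ _ ih => exact ih.symm
      | trans _ _ _ _ _ ih ih' => exact ih.trans ih'
  let θ : (Quotient (equivalence hS) →₀ ℤ) →+
      Additive (Subgroup.center (DerivedStructureGroup S)) :=
    (Finsupp.linearCombination ℤ t).toAddMonoidHom
  have hθ : θ.toMultiplicativeLeft.comp (classHom S hS) = τ := by
    refine PresentedGroup.ext fun x => ?_
    simp [classHom, θ, t]
  have hθ' (a) : θ (classHom S hS a).toAdd = Additive.ofMul (τ a) := DFunLike.congr_fun hθ a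
  have hrank : Module.rank ℤ (Quotient (equivalence hS) →₀ ℤ) =
      Nat.card (Quotient (equivalence hS)) := by
    convert rank_finsupp_self ℤ (Quotient (equivalence hS))
    rw [Nat.cast_card, Cardinal.lift_uzero]
  rw [← hrank]
  refine rank_eq_of_comp_eq_nsmul (n := n) Subgroup.FiniteIndex.index_ne_zero
    (MonoidHom.toAdditive ((classHom S hS).comp (Subgroup.subtype _))) θ
    (fun m => ?_) (fun v => ?_)
  -- On a central element the composite is the transfer, that is, the `n`-th power.
  · refine (hθ' m.toMul).trans (congrArg Additive.ofMul (Subtype.ext ?_))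
    exact MonoidHom.transferCenterPow_apply _
  -- On the basis vector of the class of `x`, `θ` gives `τ x = x ^ n`, whose class vector is `n`
  -- times the original.
  · suffices h : ((MonoidHom.toAdditive ((classHom S hS).comp (Subgroup.subtype _))).comp θ) =
        n • AddMonoidHom.id _ from DFunLike.congr_fun h v
    refine Finsupp.addHom_ext' fun c => AddMonoidHom.ext_int ?_
    obtain ⟨x, rfl⟩ := Quotient.exists_rep c
    have h1 : classHom S hS (PresentedGroup.of x) =
      Multiplicative.ofAdd (Finsupp.single (Quotient.mk _ x) 1) := by simp [classHom]
    have h2 := hθ' (PresentedGroup.of x)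
    rw [h1] at h2
    have h3 : classHom S hS (τ (PresentedGroup.of x)) =
        classHom S hS (PresentedGroup.of x) ^ n := by
      rw [← map_pow, MonoidHom.transferCenterPow_apply]
    rw [h1] at h3
    refine (congrArg (MonoidHom.toAdditive ((classHom S hS).comp (Subgroup.subtype _))) h2).trans ?_
    exact h3

end DerivedRank

theorem presentedGroup_induction {X : Type*} {rels : Set (FreeGroup X)}
    {C : PresentedGroup rels → Prop} (of : ∀ x, C (PresentedGroup.of x)) (one : C 1)
    (mul : ∀ a b, C a → C b → C (a * b)) (inv : ∀ a, C a → C a⁻¹) (a : PresentedGroup rels) :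
    C a :=
  PresentedGroup.generated_by rels
    { carrier := {a | C a}
      one_mem' := one
      mul_mem' := fun ha hb => mul _ _ ha hb
      inv_mem' := fun ha => inv _ ha } of a

/-! ### The bijective cocycle and the rank of `G_X` -/

section StructureRank

variable {X : Type u} {S : X × X → X × X}

/-- The left action of the structure group on `X`, extending `starPerm`. -/
noncomputable def starHom (hb : IsBraided S) (hS : IsNondegenerate S) :
    StructureGroup S →* Equiv.Perm X :=
  StructureGroup.lift (starPerm hS) (starPerm_mul_starPerm hb hS)

@[simp]
theorem starHom_of (hb : IsBraided S) (hS : IsNondegenerate S) (x : X) :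
    starHom hb hS (PresentedGroup.of x) = starPerm hS x :=
  StructureGroup.lift_of _ _ x

theorem phi_starHom (hb : IsBraided S) (hS : IsNondegenerate S) (h : StructureGroup S) :
    ∀ y x : X, phi hS (starHom hb hS h y) (starHom hb hS h x) = starHom hb hS h (phi hS y x) := by
  induction h using presentedGroup_induction with
  | of z => simpa using phi_starPerm_starPerm hb hS z
  | one => simp
  | mul a b ha hb' => simp [ha, hb']
  | inv a ha =>
    intro y x
    have := ha ((starHom hb hS a)⁻¹ y) ((starHom hb hS a)⁻¹ x)
    simp only [Equiv.Perm.inv_def, Equiv.apply_symm_apply] at this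
    rw [map_inv, Equiv.Perm.inv_def, this, Equiv.symm_apply_apply]

/-- The endomorphism of the derived structure group by which an element of the structure group
acts on it. -/
noncomputable def derivedEnd (hb : IsBraided S) (hS : IsNondegenerate S) (h : StructureGroup S) :
    DerivedStructureGroup S →* DerivedStructureGroup S :=
  DerivedStructureGroup.lift hS (fun x => PresentedGroup.of (starHom hb hS h x)) fun x y => by
    rw [derivedStructureGroup_rel hS, phi_starHom]

@[simp]
theorem derivedEnd_of (hb : IsBraided S) (hS : IsNondegenerate S) (h : StructureGroup S) (x : X) :
    derivedEnd hb hS h (PresentedGroup.of x) = PresentedGroup.of (starHom hb hS h x) :=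
  DerivedStructureGroup.lift_of _ _ _ x

/-- The action of the structure group on the derived structure group. -/
noncomputable def derivedAction (hb : IsBraided S) (hS : IsNondegenerate S) :
    StructureGroup S →* MulAut (DerivedStructureGroup S) where
  toFun h := (derivedEnd hb hS h).toMulEquiv (derivedEnd hb hS h⁻¹)
    (PresentedGroup.ext fun x => by simp) (PresentedGroup.ext fun x => by simp)
  map_one' := MulEquiv.toMonoidHom_injective <| PresentedGroup.ext fun x =>
    (derivedEnd_of hb hS 1 x).trans (by simp)
  map_mul' a b := MulEquiv.toMonoidHom_injective <| PresentedGroup.ext fun x =>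
    (derivedEnd_of hb hS (a * b) x).trans <| by
      simp only [map_mul, MulEquiv.toMonoidHom_eq_coe, MonoidHom.coe_coe, MulAut.mul_apply,
        MonoidHom.toMulEquiv_apply, derivedEnd_of, Equiv.Perm.mul_apply]

@[simp]
theorem derivedAction_of (hb : IsBraided S) (hS : IsNondegenerate S) (h : StructureGroup S)
    (x : X) :
    derivedAction hb hS h (PresentedGroup.of x) = PresentedGroup.of (starHom hb hS h x) :=
  derivedEnd_of hb hS h x

/-- The graph, in the semidirect product, of the cocycle which fixes the generators. -/
noncomputable def cocycleHom (hb : IsBraided S) (hS : IsNondegenerate S) :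
    StructureGroup S →* DerivedStructureGroup S ⋊[derivedAction hb hS] StructureGroup S :=
  StructureGroup.lift
    (fun x => ⟨PresentedGroup.of (starPerm hS x x), PresentedGroup.of x⟩) fun x y => by
      refine SemidirectProduct.ext ?_ (structureGroup_rel x y)
      simp only [SemidirectProduct.mul_left, derivedAction_of, starHom_of]
      have h := DFunLike.congr_fun (starPerm_mul_starPerm hb hS x y)
      simp only [Equiv.Perm.mul_apply] at h
      -- With `x₁ = f_y x`, the four factors are the images under `xy` of `x₁`, `φ(y, x₁)`, `y` and
      -- `x₁`, so the identity is the image of the relation `x₁ • y = φ(y, x₁) • x₁`.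
      have hx : starPerm hS x x =
          starHom hb hS (PresentedGroup.of x * PresentedGroup.of y) (f S y x) := by
        simp [starPerm_f]
      have hy : starPerm hS (g S x y) (g S x y) =
          starHom hb hS (PresentedGroup.of x * PresentedGroup.of y) (phi hS y (f S y x)) := by
        simp [phi_f, h, starPerm_f]
      have hy' : starPerm hS x (starPerm hS y y) =
          starHom hb hS (PresentedGroup.of x * PresentedGroup.of y) y := by
        simp
      have hx' : starPerm hS (g S x y) (starPerm hS (f S y x) (f S y x)) =
          starHom hb hS (PresentedGroup.of x * PresentedGroup.of y) (f S y x) := by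
        simp [h]
      rw [hx, hy, hx', hy', derivedStructureGroup_rel hS, phi_starHom]

theorem cocycleHom_right (hb : IsBraided S) (hS : IsNondegenerate S) (h : StructureGroup S) :
    (cocycleHom hb hS h).right = h := by
  have : SemidirectProduct.rightHom.comp (cocycleHom hb hS) = MonoidHom.id _ :=
    PresentedGroup.ext fun x => by simp [cocycleHom]
  exact DFunLike.congr_fun this h

/-- The cocycle from the structure group to the derived structure group which fixes the
generators. -/
noncomputable def cocycle (hb : IsBraided S) (hS : IsNondegenerate S) (h : StructureGroup S) :
    DerivedStructureGroup S :=
  -- The left component of a generator `x` is `x * x`; acting by `x⁻¹` restores `x`.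
  (derivedAction hb hS h)⁻¹ (cocycleHom hb hS h).left

theorem cocycle_one (hb : IsBraided S) (hS : IsNondegenerate S) : cocycle hb hS 1 = 1 := by
  simp [cocycle]

theorem cocycle_of (hb : IsBraided S) (hS : IsNondegenerate S) (x : X) :
    cocycle hb hS (PresentedGroup.of x) = PresentedGroup.of x := by
  rw [cocycle, MulAut.inv_apply, MulEquiv.symm_apply_eq, derivedAction_of]
  simp [cocycleHom]

theorem cocycle_mul (hb : IsBraided S) (hS : IsNondegenerate S) (h k : StructureGroup S) :
    cocycle hb hS (h * k) = (derivedAction hb hS k)⁻¹ (cocycle hb hS h) * cocycle hb hS k := by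
  simp [cocycle, cocycleHom_right, MulAut.mul_apply]

theorem cocycle_mul_of_mem_ker (hb : IsBraided S) (hS : IsNondegenerate S)
    (h k : StructureGroup S) (hk : k ∈ (starHom hb hS).ker) :
    cocycle hb hS (h * k) = cocycle hb hS h * cocycle hb hS k := by
  have : derivedAction hb hS k = 1 :=
    MulEquiv.toMonoidHom_injective <| PresentedGroup.ext fun x => by
      simp [MonoidHom.mem_ker.1 hk]
  rw [cocycle_mul, this]
  simp

variable [Finite X]

/-- From `t = (h * y) h` one gets `t * y = w * w` with `w = h * y`. Since `w ↦ w * w` is bijective,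
`t` determines `w`, and then `h = w⁻¹ t`. -/
theorem twistedMul_bijective (hb : IsBraided S) (hS : IsNondegenerate S) (y : X) :
    Function.Bijective fun h : StructureGroup S =>
      (PresentedGroup.of (starHom hb hS h y) * h : StructureGroup S) := by
  have key (h : StructureGroup S) :
      starHom hb hS (PresentedGroup.of (starHom hb hS h y) * h) y =
        starPerm hS (starHom hb hS h y) (starHom hb hS h y) := by simp
  constructor
  · intro h k e
    have e' : starHom hb hS h y = starHom hb hS k y := by
      refine (starPerm_self_bijective hb hS).1 ?_
      simp only [← key]
      exact congrArg (fun t => starHom hb hS t y) e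
    simpa [e'] using e
  · intro t
    obtain ⟨w, hw⟩ := (starPerm_self_bijective hb hS).2 (starHom hb hS t y)
    refine ⟨(PresentedGroup.of w)⁻¹ * t, ?_⟩
    have : starHom hb hS ((PresentedGroup.of w)⁻¹ * t) y = w := by
      rw [map_mul, Equiv.Perm.mul_apply, ← hw, map_inv, starHom_of, Equiv.Perm.inv_def,
        Equiv.symm_apply_apply]
    simp only [this, mul_inv_cancel_left]

/-- The action of the derived structure group on the structure group, in which a generator `y`
sends `h` to `(h * y) h`. -/
noncomputable def twistedAction (hb : IsBraided S) (hS : IsNondegenerate S) :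
    DerivedStructureGroup S →* Equiv.Perm (StructureGroup S) :=
  DerivedStructureGroup.lift hS (fun y => Equiv.ofBijective _ (twistedMul_bijective hb hS y))
    fun x y => by
      ext h
      -- With `u = h * y` and `h * x = f_u a`, the two sides become `a u h` and `g_a(u) f_u(a) h`,
      -- which agree by the relation of `G_X`.
      obtain ⟨a, ha⟩ : ∃ a, f S (starHom hb hS h y) a = starHom hb hS h x :=
        (hS.f_bijective _).2 _
      have h1 : starHom hb hS (PresentedGroup.of (starHom hb hS h y) * h) x = a := by
        simp [← ha, starPerm_f]
      have h2 : starHom hb hS (PresentedGroup.of (starHom hb hS h x) * h) (phi hS y x) =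
          g S a (starHom hb hS h y) := by
        rw [map_mul, Equiv.Perm.mul_apply, ← phi_starHom, starHom_of, ← ha, phi_f, starPerm_f]
      simp only [Equiv.Perm.mul_apply, Equiv.ofBijective_apply]
      rw [h1, h2, ← mul_assoc, ← mul_assoc, structureGroup_rel, ha]

@[simp]
theorem twistedAction_of (hb : IsBraided S) (hS : IsNondegenerate S) (y : X)
    (h : StructureGroup S) : twistedAction hb hS (PresentedGroup.of y) h =
      PresentedGroup.of (starHom hb hS h y) * h := by
  simp [twistedAction]

/-- On a generator, the cocycle law acts on `h * y` by `h⁻¹` and returns `y`. Thus the cocycle turns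
the twisted action into left translation. -/
theorem cocycle_twistedAction (hb : IsBraided S) (hS : IsNondegenerate S)
    (a : DerivedStructureGroup S) :
    ∀ h, cocycle hb hS (twistedAction hb hS a h) = a * cocycle hb hS h := by
  induction a using presentedGroup_induction with
  | of y =>
    intro h
    rw [twistedAction_of, cocycle_mul, cocycle_of, MulAut.inv_apply, ← derivedAction_of,
      MulEquiv.symm_apply_apply]
  | one => simp
  | mul a b ha hb' => simp [ha, hb', mul_assoc]
  | inv a ha =>
    intro h
    have := ha ((twistedAction hb hS a)⁻¹ h)
    rw [Equiv.Perm.inv_def, Equiv.apply_symm_apply] at this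
    rw [map_inv, Equiv.Perm.inv_def, this, inv_mul_cancel_left]

/-- Transitivity of the twisted action: left multiplication of `h` by a generator `x` is the action
of the generator `h⁻¹ * x`. -/
theorem exists_twistedAction_eq_mul (hb : IsBraided S) (hS : IsNondegenerate S)
    (k : StructureGroup S) : ∀ h, ∃ a, twistedAction hb hS a h = k * h := by
  induction k using presentedGroup_induction with
  | of x =>
    intro h
    exact ⟨PresentedGroup.of ((starHom hb hS h)⁻¹ x), by
      rw [twistedAction_of, Equiv.Perm.inv_def, Equiv.apply_symm_apply]⟩
  | one => exact fun h => ⟨1, by simp⟩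
  | mul k l hk hl =>
    intro h
    obtain ⟨a, ha⟩ := hl h
    obtain ⟨b, hb'⟩ := hk (l * h)
    exact ⟨b * a, by rw [map_mul, Equiv.Perm.mul_apply, ha, hb', mul_assoc]⟩
  | inv k hk =>
    intro h
    obtain ⟨a, ha⟩ := hk (k⁻¹ * h)
    rw [mul_inv_cancel_left] at ha
    exact ⟨a⁻¹, by rw [map_inv, Equiv.Perm.inv_eq_iff_eq, ha]⟩

/-- The orbit map `a ↦ a · 1` of the twisted action is surjective by transitivity and has the
cocycle as a left inverse, so the two are mutually inverse. -/
theorem cocycle_bijective (hb : IsBraided S) (hS : IsNondegenerate S) :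
    Function.Bijective (cocycle hb hS) := by
  have key (a) : cocycle hb hS (twistedAction hb hS a 1) = a := by
    rw [cocycle_twistedAction, cocycle_one, mul_one]
  refine ⟨fun h k e => ?_, fun a => ⟨_, key a⟩⟩
  obtain ⟨a, ha⟩ := exists_twistedAction_eq_mul hb hS h 1
  obtain ⟨b, hb'⟩ := exists_twistedAction_eq_mul hb hS k 1
  rw [mul_one] at ha hb'
  rw [← ha, ← hb', key, key] at e
  rw [← ha, ← hb', e]

theorem structureGroup_hasRank (hb : IsBraided S) (hS : IsNondegenerate S) :
    HasRank (StructureGroup S) (Nat.card (Quotient (equivalence hS))) :=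
  (derivedStructureGroup_hasRank hS).of_bijective (starHom hb hS).ker (cocycle hb hS)
    (cocycle_bijective hb hS) (cocycle_mul_of_mem_ker hb hS)

end StructureRank

end BraidedSet

theorem mainTheorem3 {X : Type*} [Finite X] (S : X × X → X × X)
    (hbraid : BraidedSet.IsBraided S) (hnd : BraidedSet.IsNondegenerate S) :
    BraidedSet.HasRank (BraidedSet.DerivedStructureGroup S)
        (Nat.card (Quotient (BraidedSet.equivalence hnd))) ∧
      BraidedSet.HasRank (BraidedSet.StructureGroup S)
        (Nat.card (Quotient (BraidedSet.equivalence hnd))) :=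
  ⟨BraidedSet.derivedStructureGroup_hasRank hnd, BraidedSet.structureGroup_hasRank hbraid hnd⟩
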